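/- Let $K=(V,E_1,E_2)$ be a nonempty, weakly connected, finite or infinite digraph whose edges are coloured with colours $1,2$ ($E_i$ is the set of edges of colour $i$, called $i$-edges). Consider the following axioms. (A1) For $i=1,2$, each connected component of $(V,E_i)$ is a finite simple directed path (possibly a single vertex); it is called an $i$-line. Given (A1), for a vertex $v$ let $P_i^{\rm in}(v)$ and $P_i^{\rm out}(v)$ be the part of the $i$-line through $v$ from its first vertex to $v$, respectively from $v$ to its last vertex, and let $t_i(v)$ and $h_i(v)$ be the numbers of edges of these parts. (A2) Each $i$-line ($i=1,2$) contains a vertex $r$ such that $t_{3-i}(v)=t_{3-i}(u)-1$ and $h_{3-i}(v)=h_{3-i}(u)$ for each edge $(u,v)$ of $P_i^{\rm in}(r)$, and $t_{3-i}(v)=t_{3-i}(u)$ and $h_{3-i}(v)=h_{3-i}(u)+1$ for each edge $(u,v)$ of $P_i^{\rm out}(r)$. The label $\ell(u,v)$ of an $i$-edge $(u,v)$ is $0$ if $h_{3-i}(u)=h_{3-i}(v)$, and $1$ otherwise. Write $v=F_i(u)$ and $u=F_i^{-1}(v)$ if $(u,v)$ is an $i$-edge; an equality between expressions in the $F_i^{\pm1}$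 includes the assertion that all edges involved exist. (A3) (a) If a vertex $u$ has two outgoing edges $(u,v),(u,v')$ and $\ell(u,v)=0$, then $\ell(u,v')=1$ and $F_2F_1(u)=F_1F_2(u)$. (b) If a vertex $v$ has two incoming edges $(u,v),(u',v)$ and $\ell(u,v)=1$, then $\ell(u',v)=0$ and $F_2^{-1}F_1^{-1}(v)=F_1^{-1}F_2^{-1}(v)$. (A4) (i) If a vertex $u$ has two outgoing edges both labelled $1$, then $F_1F_2^2F_1(u)=F_2F_1^2F_2(u)$. (ii) If a vertex $v$ has two incoming edges both labelled $0$, then $F_1^{-1}F_2^{-2}F_1^{-1}(v)=F_2^{-1}F_1^{-2}F_2^{-1}(v)$. A source is a vertex with no incoming edge, and a sink is a vertex with no outgoing edge. A WC-graph is a nonempty weakly connected digraph as above that satisfies (A1)--(A3), and an RC-graph is one that satisfies (A1)--(A4). Suppose that $K$ satisfies (A1)--(A3). Then (A4) holds if and only if $K$ has exactly one source, and also if and only if $K$ has exactly one sink. In other words, the RC-graphs are precisely the WC-graphs with exactly one source, and precisely the WC-graphs with exactly one sink. -/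

import Mathlib

/-- A digraph on the vertex set `V` whose edges are coloured with two colours.  The colours
`1` and `2` are the elements `0` and `1` of `Fin 2`; `K.E i u v` says that there is an edge of
colour `i` from `u` to `v`.  The opposite colour of `i` is `i.rev`.  Edges of different colours may
be parallel, so each of the two sets of edges is an arbitrary set of ordered pairs. -/
structure TwoColoredDigraph (V : Type*) where
  /-- the edges of each colour -/
  E : Fin 2 → V → V → Prop

namespace TwoColoredDigraph

/-- (Weak) connectedness: the digraph is nonempty, and any two vertices are joined by a path when
the directions and the colours of the edges are ignored. -/
def IsConnected {V : Type*} (K : TwoColoredDigraph V) : Prop :=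
  Nonempty V ∧ ∀ u v : V, Relation.EqvGen (fun x y => ∃ i, K.E i x y) u v

/-- The vertex set of the connected component of `v` in the monochromatic subgraph `(V, E i)`.
In a digraph satisfying `A1` this is the vertex set of the `i`-line through `v`. -/
def line {V : Type*} (K : TwoColoredDigraph V) (i : Fin 2) (v : V) : Set V :=
  {w | Relation.EqvGen (K.E i) v w}

/-- Axiom (A1): every connected component of `(V, E i)` is a finite simple directed path
`p 0, p 1, …, p n`. -/
def A1 {V : Type*} (K : TwoColoredDigraph V) : Prop :=
  ∀ (i : Fin 2) (v : V), ∃ (n : ℕ) (p : Fin (n + 1) → V),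
    Function.Injective p ∧ Set.range p = K.line i v ∧
    ∀ x ∈ K.line i v, ∀ y ∈ K.line i v,
      (K.E i x y ↔ ∃ k : Fin n, x = p k.castSucc ∧ y = p k.succ)

/-- The edges of the part `Pⁱⁿ_i(v)` of the `i`-line through `v` that runs from its first vertex
to `v`. -/
def inEdges {V : Type*} (K : TwoColoredDigraph V) (i : Fin 2) (v : V) : Set (V × V) :=
  {e | K.E i e.1 e.2 ∧ Relation.ReflTransGen (K.E i) e.2 v}

/-- The edges of the part `Pᵒᵘᵗ_i(v)` of the `i`-line through `v` that runs from `v` to its last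
vertex. -/
def outEdges {V : Type*} (K : TwoColoredDigraph V) (i : Fin 2) (v : V) : Set (V × V) :=
  {e | K.E i e.1 e.2 ∧ Relation.ReflTransGen (K.E i) v e.1}

/-- The length `t_i(v)` of `Pⁱⁿ_i(v)`. -/
noncomputable def t {V : Type*} (K : TwoColoredDigraph V) (i : Fin 2) (v : V) : ℕ :=
  (K.inEdges i v).ncard

/-- The length `h_i(v)` of `Pᵒᵘᵗ_i(v)`. -/
noncomputable def h {V : Type*} (K : TwoColoredDigraph V) (i : Fin 2) (v : V) : ℕ :=
  (K.outEdges i v).ncard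

/-- Axiom (A2): every `i`-line contains a (critical) vertex `r` such that along each edge of the
line before `r` the length `t` of the other colour drops by one and `h` is unchanged, and along
each edge after `r` the length `t` is unchanged and `h` grows by one. -/
def A2 {V : Type*} (K : TwoColoredDigraph V) : Prop :=
  ∀ (i : Fin 2) (x : V), ∃ r ∈ K.line i x,
    (∀ u v, (u, v) ∈ K.inEdges i r →
      (K.t i.rev v : ℤ) = (K.t i.rev u : ℤ) - 1 ∧ K.h i.rev v = K.h i.rev u) ∧
    (∀ u v, (u, v) ∈ K.outEdges i r →
      K.t i.rev v = K.t i.rev u ∧ K.h i.rev v = K.h i.rev u + 1)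

/-- The label of an edge `(u, v)` of colour `i`. -/
noncomputable def label {V : Type*} (K : TwoColoredDigraph V) (i : Fin 2) (u v : V) : ℕ :=
  if K.h i.rev u = K.h i.rev v then 0 else 1

/-- `K.Walk [i₁, …, iₖ] u w` says that one gets from `u` to `w` by traversing, in this order and
in forward direction, edges of colours `i₁, …, iₖ`.  With `F_i` denoting the move along an edge of
colour `i`, it says that `F_{iₖ} ⋯ F_{i₁} (u)` is defined and equal to `w`; equivalently, that
`F_{i₁}⁻¹ ⋯ F_{iₖ}⁻¹ (w)` is defined and equal to `u`. -/
def Walk {V : Type*} (K : TwoColoredDigraph V) : List (Fin 2) → V → V → Prop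
  | [], u, w => u = w
  | i :: l, u, w => ∃ v, K.E i u v ∧ Walk K l v w

/-- Axiom (A3).  Part (a): if `u` has two outgoing edges, one of them labelled `0`, then the other
is labelled `1`, and `F₂F₁(u) = F₁F₂(u)`.  Part (b): if `v` has two incoming edges, one of them
labelled `1`, then the other is labelled `0`, and `F₂⁻¹F₁⁻¹(v) = F₁⁻¹F₂⁻¹(v)`. -/
def A3 {V : Type*} (K : TwoColoredDigraph V) : Prop :=
  (∀ (i : Fin 2) (u v v' : V), K.E i u v → K.E i.rev u v' → K.label i u v = 0 →
    K.label i.rev u v' = 1 ∧ ∃ w, K.Walk [0, 1] u w ∧ K.Walk [1, 0] u w) ∧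
  (∀ (i : Fin 2) (u u' v : V), K.E i u v → K.E i.rev u' v → K.label i u v = 1 →
    K.label i.rev u' v = 0 ∧ ∃ w, K.Walk [1, 0] w v ∧ K.Walk [0, 1] w v)

/-- Axiom (A4).  Part (i): if `u` has two outgoing edges both labelled `1`, then
`F₁F₂²F₁(u) = F₂F₁²F₂(u)`.  Part (ii): if `v` has two incoming edges both labelled `0`, then
`F₁⁻¹F₂⁻²F₁⁻¹(v) = F₂⁻¹F₁⁻²F₂⁻¹(v)`. -/
def A4 {V : Type*} (K : TwoColoredDigraph V) : Prop :=
  (∀ u v v' : V, K.E 0 u v → K.E 1 u v' → K.label 0 u v = 1 → K.label 1 u v' = 1 →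
    ∃ w, K.Walk [0, 1, 1, 0] u w ∧ K.Walk [1, 0, 0, 1] u w) ∧
  (∀ u u' v : V, K.E 0 u v → K.E 1 u' v → K.label 0 u v = 0 → K.label 1 u' v = 0 →
    ∃ w, K.Walk [0, 1, 1, 0] w v ∧ K.Walk [1, 0, 0, 1] w v)

/-- A WC-graph: a connected digraph satisfying (A1), (A2), (A3). -/
def IsWCGraph {V : Type*} (K : TwoColoredDigraph V) : Prop :=
  K.IsConnected ∧ K.A1 ∧ K.A2 ∧ K.A3

/-- An RC-graph: a connected digraph satisfying (A1), (A2), (A3), (A4). -/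
def IsRCGraph {V : Type*} (K : TwoColoredDigraph V) : Prop :=
  K.IsConnected ∧ K.A1 ∧ K.A2 ∧ K.A3 ∧ K.A4

/-- A source: a vertex of zero indegree. -/
def IsSource {V : Type*} (K : TwoColoredDigraph V) (s : V) : Prop :=
  ∀ (i : Fin 2) (u : V), ¬ K.E i u s

/-- A sink: a vertex of zero outdegree. -/
def IsSink {V : Type*} (K : TwoColoredDigraph V) (s : V) : Prop :=
  ∀ (i : Fin 2) (v : V), ¬ K.E i s v

end TwoColoredDigraph

/-! The proof uses only the local rules collected in `Labelling`; they are invariant under reversing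
all edges, so the sink statement is the source statement for the reversed digraph. (A4) gives one
source by Newman's diamond argument. Walking backwards terminates (`wellFounded_edge`), and two
edges into one vertex have tails with a common ancestor, by (A3) or by (A4)(ii). Hence every vertex
is reached from exactly one source, and connectedness makes this source global. Conversely, each
pair of edges in (A4) meets at a critical vertex, and both words in (A4) split into two two-edge
moves between critical vertices, each shifting one of `t 0`, `t 1` by one. Moving down by such steps
ends at a source; if the source is unique, a critical vertex is determined by `t 0` and `t 1`
(`IsCritical.eq_of_t_eq`), so the two walks meet. -/

namespace TwoColoredDigraph

variable {V : Type*}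

/-! ### Local rules and their symmetry under reversal -/

/-- The local rules of a WC-graph: its edges are split into those labelled `0` and those labelled
`1`, and `t`, `h` record the distances to the ends of the lines. -/
structure Labelling (K : TwoColoredDigraph V) where
  /-- the edges labelled `0` -/
  E₀ : Fin 2 → V → V → Prop
  /-- the edges labelled `1` -/
  E₁ : Fin 2 → V → V → Prop
  /-- the distance from the beginning of a line -/
  t : Fin 2 → V → ℕ
  /-- the distance to the end of a line -/
  h : Fin 2 → V → ℕ
  edge_iff : ∀ {i u v}, K.E i u v ↔ E₀ i u v ∨ E₁ i u v
  out_unique : ∀ {i u v v'}, K.E i u v → K.E i u v' → v = v'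
  in_unique : ∀ {i u u' v}, K.E i u v → K.E i u' v → u = u'
  exists_in : ∀ {i v}, 0 < t i v → ∃ u, K.E i u v
  exists_out : ∀ {i v}, 0 < h i v → ∃ w, K.E i v w
  step : ∀ {i u v}, K.E i u v → t i v = t i u + 1 ∧ h i u = h i v + 1
  step₀ : ∀ {i u v}, E₀ i u v → t i.rev u = t i.rev v + 1 ∧ h i.rev u = h i.rev v
  step₁ : ∀ {i u v}, E₁ i u v → t i.rev u = t i.rev v ∧ h i.rev v = h i.rev u + 1
  square_out : ∀ {i u v v'}, E₀ i u v → K.E i.rev u v' →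
    E₁ i.rev u v' ∧ ∃ w, K.E i.rev v w ∧ K.E i v' w
  square_in : ∀ {i u u' v}, E₁ i u v → K.E i.rev u' v →
    E₀ i.rev u' v ∧ ∃ w, K.E i.rev w u ∧ K.E i w u'

/-- The digraph with all edges reversed. -/
def reverse (K : TwoColoredDigraph V) : TwoColoredDigraph V where
  E i u v := K.E i v u

namespace Labelling

variable {K : TwoColoredDigraph V} (L : Labelling K)

/-- Reversing the edges exchanges the two labels, and `t` with `h`. -/
def reverse : Labelling K.reverse where
  E₀ i u v := L.E₁ i v u
  E₁ i u v := L.E₀ i v u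
  t := L.h
  h := L.t
  edge_iff := L.edge_iff.trans or_comm
  out_unique := L.in_unique
  in_unique := L.out_unique
  exists_in := L.exists_out
  exists_out := L.exists_in
  step h := ⟨(L.step h).2, (L.step h).1⟩
  step₀ h := ⟨(L.step₁ h).2, (L.step₁ h).1.symm⟩
  step₁ h := ⟨(L.step₀ h).2.symm, (L.step₀ h).1⟩
  square_out := L.square_in
  square_in := L.square_out

variable {L}

theorem edge₀ {i u v} (e : L.E₀ i u v) : K.E i u v := L.edge_iff.2 (.inl e)

theorem edge₁ {i u v} (e : L.E₁ i u v) : K.E i u v := L.edge_iff.2 (.inr e)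

/-- Since `h i.rev` agrees at `x` and `u`, `x` also has an outgoing edge of the other colour. The
resulting square closes at `v` and forces `t i u = t i v`, whereas the label `0` of the second edge
makes `t` drop. -/
theorem not_E₀_rev_of_E₀ {i : Fin 2} {x u v} (e : L.E₀ i x u) : ¬ L.E₀ i.rev u v := by
  intro f
  have h₁ := L.step₀ e
  have h₂ := L.step (edge₀ f)
  have h₃ := L.step₀ f
  rw [Fin.rev_rev] at h₃
  obtain ⟨y, hy⟩ := L.exists_out (i := i.rev) (v := x) (by omega)
  obtain ⟨hy₁, w, hw, hyw⟩ := L.square_out e hy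
  obtain rfl := L.out_unique (edge₀ f) hw
  have h₄ := L.step₁ hy₁
  rw [Fin.rev_rev] at h₄
  have h₅ := L.step hyw
  have h₆ := L.step (edge₀ e)
  omega

theorem not_E₁_rev_of_E₁ {i : Fin 2} {x u v} (e : L.E₁ i x u) : ¬ L.E₁ i.rev u v := fun f => by
  have := not_E₀_rev_of_E₀ (L := L.reverse) (i := i.rev) (x := v) (u := u) (v := x) f
  rw [Fin.rev_rev] at this
  exact this e

theorem rev_edge {i : Fin 2} {u v} {P : Fin 2 → V → V → Prop} (e : P i u v) : P i.rev.rev u v := by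
  rwa [Fin.rev_rev]

/-! ### Backward walks terminate -/

theorem t_add_t_rev₁ {i : Fin 2} {u v} (e : L.E₁ i u v) :
    L.t i u + L.t i.rev u < L.t i v + L.t i.rev v := by
  have := L.step (edge₁ e); have := L.step₁ e; omega

theorem t_add_t_rev₀ {i : Fin 2} {u v} (e : L.E₀ i u v) :
    L.t i u + L.t i.rev u = L.t i v + L.t i.rev v := by
  have := L.step (edge₀ e); have := L.step₀ e; omega

theorem t_add_rev (i : Fin 2) (v : V) : L.t i v + L.t i.rev v = L.t 0 v + L.t 1 v := by
  fin_cases i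
  · rfl
  · exact add_comm _ _

theorem eq_or_eq_rev (i j : Fin 2) : j = i ∨ j = i.rev := by
  fin_cases i <;> fin_cases j <;> simp [Fin.rev]

variable (L)

/-- Edges labelled `0` preserve `t 0 + t 1`, but consecutive ones have the same colour by
`not_E₀_rev_of_E₀`, so going back along them lowers `t i`. An edge labelled `1` drops to a smaller
sum. -/
theorem acc_of_lt {n : ℕ}
    (ih : ∀ v, L.t 0 v + L.t 1 v < n → Acc (fun u v => ∃ i, K.E i u v) v) (i : Fin 2) (m : ℕ) :
    ∀ u v, L.t i u = m → L.E₀ i u v → L.t 0 v + L.t 1 v = n →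
      Acc (fun u v => ∃ i, K.E i u v) u := by
  induction m using Nat.strong_induction_on with
  | _ m ihm =>
    intro u v hm e hn
    refine ⟨_, fun x ⟨j, hx⟩ => ?_⟩
    have hu := t_add_t_rev₀ e
    rw [t_add_rev, t_add_rev] at hu
    rcases L.edge_iff.1 hx with hx₀ | hx₁
    · rcases eq_or_eq_rev i j with rfl | rfl
      · have := L.step hx
        exact ihm _ (by omega) x u rfl hx₀ (by omega)
      · exact (not_E₀_rev_of_E₀ hx₀ (rev_edge (P := L.E₀) e)).elim
    · have := t_add_t_rev₁ hx₁
      rw [t_add_rev, t_add_rev] at this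
      exact ih _ (by omega)

theorem wellFounded_edge (L : Labelling K) : WellFounded (fun u v => ∃ i, K.E i u v) := by
  refine ⟨fun v => ?_⟩
  induction hn : L.t 0 v + L.t 1 v using Nat.strong_induction_on generalizing v with
  | _ n ih =>
    refine ⟨_, fun u ⟨i, e⟩ => ?_⟩
    have ih' := fun v hv => ih _ hv v rfl
    rcases L.edge_iff.1 e with e₀ | e₁
    · exact L.acc_of_lt ih' i _ u v rfl e₀ hn
    · have := t_add_t_rev₁ e₁
      rw [t_add_rev, t_add_rev] at this
      exact ih' _ (by omega)

theorem exists_source_reaching (L : Labelling K) (v : V) :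
    ∃ s, K.IsSource s ∧ Relation.ReflTransGen (fun u v => ∃ i, K.E i u v) s v := by
  induction v using L.wellFounded_edge.induction with
  | _ v ih =>
    by_cases hv : K.IsSource v
    · exact ⟨v, hv, .refl⟩
    · simp only [IsSource, not_forall, not_not] at hv
      obtain ⟨i, u, e⟩ := hv
      obtain ⟨s, hs, hsu⟩ := ih u ⟨i, e⟩
      exact ⟨s, hs, hsu.tail ⟨i, e⟩⟩

/-! ### Confluence and uniqueness of the source -/

theorem exists_common_ancestor
    (hA4 : ∀ u u' v, L.E₀ 0 u v → L.E₀ 1 u' v → ∃ w,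
      Relation.ReflTransGen (fun u v => ∃ i, K.E i u v) w u ∧
      Relation.ReflTransGen (fun u v => ∃ i, K.E i u v) w u')
    {i j : Fin 2} {u u' v : V} (e : K.E i u v) (e' : K.E j u' v) :
    ∃ w, Relation.ReflTransGen (fun u v => ∃ i, K.E i u v) w u ∧
      Relation.ReflTransGen (fun u v => ∃ i, K.E i u v) w u' := by
  rcases eq_or_eq_rev i j with rfl | rfl
  · obtain rfl := L.in_unique e e'
    exact ⟨u, .refl, .refl⟩
  · rcases L.edge_iff.1 e with e₀ | e₁
    · rcases L.edge_iff.1 e' with e₀' | e₁'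
      · fin_cases i
        · exact hA4 _ _ _ e₀ e₀'
        · obtain ⟨w, h₁, h₂⟩ := hA4 _ _ _ e₀' e₀
          exact ⟨w, h₂, h₁⟩
      · obtain ⟨-, w, h₁, h₂⟩ := L.square_in e₁' (rev_edge (P := K.E) e)
        exact ⟨w, .single ⟨_, h₂⟩, .single ⟨_, h₁⟩⟩
    · obtain ⟨-, w, h₁, h₂⟩ := L.square_in e₁ e'
      exact ⟨w, .single ⟨_, h₁⟩, .single ⟨_, h₂⟩⟩

theorem source_reaching_unique
    (hA4 : ∀ u u' v, L.E₀ 0 u v → L.E₀ 1 u' v → ∃ w,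
      Relation.ReflTransGen (fun u v => ∃ i, K.E i u v) w u ∧
      Relation.ReflTransGen (fun u v => ∃ i, K.E i u v) w u') (v : V) :
    ∀ s s', K.IsSource s → K.IsSource s' →
      Relation.ReflTransGen (fun u v => ∃ i, K.E i u v) s v →
      Relation.ReflTransGen (fun u v => ∃ i, K.E i u v) s' v → s = s' := by
  induction v using L.wellFounded_edge.induction with
  | _ v ih =>
    intro s s' hs hs' hsv hsv'
    rcases hsv.cases_tail with rfl | ⟨u, hsu, i, e⟩
    · rcases hsv'.cases_tail with rfl | ⟨u, -, i, e⟩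
      · rfl
      · exact (hs i u e).elim
    rcases hsv'.cases_tail with rfl | ⟨u', hsu', j, e'⟩
    · exact (hs' i u e).elim
    obtain ⟨w, hw, hw'⟩ := L.exists_common_ancestor hA4 e e'
    obtain ⟨r, hr, hrw⟩ := L.exists_source_reaching w
    -- A source `r` above the common ancestor `w` reaches both `u` and `u'`, so it equals both `s`
    -- and `s'`.
    exact (ih u ⟨i, e⟩ s r hs hr hsu (hrw.trans hw)).trans
      (ih u' ⟨j, e'⟩ r s' hr hs' (hrw.trans hw') hsu')

theorem existsUnique_source (hK : K.IsConnected)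
    (hA4 : ∀ u u' v, L.E₀ 0 u v → L.E₀ 1 u' v → ∃ w,
      Relation.ReflTransGen (fun u v => ∃ i, K.E i u v) w u ∧
      Relation.ReflTransGen (fun u v => ∃ i, K.E i u v) w u') : ∃! s, K.IsSource s := by
  obtain ⟨⟨v⟩, hconn⟩ := hK
  -- The set of sources reaching a vertex does not change along an edge, hence is constant on the
  -- component.
  have key : ∀ u w, Relation.EqvGen (fun x y => ∃ i, K.E i x y) u w → ∀ s, K.IsSource s →
      (Relation.ReflTransGen (fun u v => ∃ i, K.E i u v) s u ↔
        Relation.ReflTransGen (fun u v => ∃ i, K.E i u v) s w) := by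
    intro u w huw s hs
    induction huw with
    | rel x y hxy =>
      refine ⟨fun h => h.tail hxy, fun h => ?_⟩
      obtain ⟨r, hr, hrx⟩ := L.exists_source_reaching x
      rwa [L.source_reaching_unique hA4 y s r hs hr h (hrx.tail hxy)]
    | refl x => rfl
    | symm x y _ ih => exact ih.symm
    | trans x y z _ _ ih₁ ih₂ => exact ih₁.trans ih₂
  obtain ⟨s, hs, -⟩ := L.exists_source_reaching v
  exact ⟨s, hs, fun s' hs' =>
    L.source_reaching_unique hA4 s s' s hs' hs ((key s' s (hconn _ _) s' hs').1 .refl) .refl⟩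

/-! ### Critical vertices and (A4) from a unique source -/

/-- Critical vertices: those at which the label changes from `0` to `1` on both lines. -/
def IsCritical (L : Labelling K) (c : V) : Prop :=
  ∀ i u, ¬ L.E₁ i u c ∧ ¬ L.E₀ i c u

theorem IsCritical.reverse {L : Labelling K} {c : V} (hc : L.IsCritical c) : L.reverse.IsCritical c :=
  fun i u => (hc i u).symm

theorem isCritical_of_E₁ {u v v' : V} (e : L.E₁ 0 u v) (e' : L.E₁ 1 u v') : L.IsCritical u := by
  have key : ∀ (i : Fin 2) {v v'}, L.E₁ i u v → L.E₁ i.rev u v' →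
      ∀ x, ¬ L.E₁ i x u ∧ ¬ L.E₀ i u x := by
    refine fun i v v' e e' x => ⟨fun f => not_E₁_rev_of_E₁ f e', fun f => ?_⟩
    obtain rfl := L.out_unique (edge₀ f) (edge₁ e)
    have := L.step₁ e; have := L.step₀ f; omega
  intro i
  fin_cases i
  exacts [key 0 e e', key 1 e' e]

/-- Two consecutive edges of different colours lead from a critical vertex to a critical one. -/
theorem IsCritical.exists_next {L : Labelling K} {c : V} (hc : L.IsCritical c) {i : Fin 2} (hi : 0 < L.h i c) :
    ∃ v d, K.E i c v ∧ K.E i.rev v d ∧ L.IsCritical d ∧ L.t i d = L.t i c ∧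
      L.t i.rev d = L.t i.rev c + 1 ∧ L.h i c = L.h i d + 1 ∧ L.h i.rev d = L.h i.rev c := by
  obtain ⟨v, hv⟩ := L.exists_out hi
  have hv₁ : L.E₁ i c v := (L.edge_iff.1 hv).resolve_left (hc i v).2
  have h₁ := L.step hv
  have h₂ := L.step₁ hv₁
  obtain ⟨d, hd⟩ := L.exists_out (i := i.rev) (v := v) (by omega)
  have hd₀ : L.E₀ i.rev v d := (L.edge_iff.1 hd).resolve_right (not_E₁_rev_of_E₁ hv₁)
  have h₃ := L.step hd
  have h₄ := L.step₀ hd₀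
  rw [Fin.rev_rev] at h₄
  -- Such an edge would complete a square with bottom vertex `c`; the square's other edge out of `c`
  -- is labelled `1` by criticality, giving two consecutive edges labelled `1` of different colours.
  have hin : ∀ x, ¬ L.E₁ i x d := by
    intro x hx
    obtain ⟨-, w, hwx, hwv⟩ := L.square_in hx hd
    obtain rfl := L.in_unique hv hwv
    exact not_E₁_rev_of_E₁ ((L.edge_iff.1 hwx).resolve_left (hc _ _).2)
      (rev_edge (P := L.E₁) hx)
  refine ⟨v, d, hv, hd, fun j x => ?_, by omega, by omega, by omega, by omega⟩
  rcases eq_or_eq_rev i j with rfl | rfl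
  · refine ⟨hin x, fun hx => not_E₀_rev_of_E₀ hd₀ (rev_edge (P := L.E₀) hx)⟩
  · refine ⟨fun hx => ?_, fun hx => ?_⟩
    · obtain rfl := L.in_unique hd (edge₁ hx)
      have := L.step₁ hx
      rw [Fin.rev_rev] at this
      omega
    · have h₅ := L.step₀ hx
      rw [Fin.rev_rev] at h₅
      -- The label `0` makes `t i` drop after `d`, so `d` is not first on its `i`-line.
      obtain ⟨y, hy⟩ := L.exists_in (i := i) (v := d) (by omega)
      exact not_E₀_rev_of_E₀ ((L.edge_iff.1 hy).resolve_right (hin y)) hx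

theorem IsCritical.exists_prev {L : Labelling K} {c : V} (hc : L.IsCritical c) {i : Fin 2} (hi : 0 < L.t i.rev c) :
    ∃ d v, K.E i d v ∧ K.E i.rev v c ∧ L.IsCritical d ∧ L.t i d = L.t i c ∧
      L.t i.rev c = L.t i.rev d + 1 ∧ L.h i d = L.h i c + 1 ∧ L.h i.rev d = L.h i.rev c := by
  obtain ⟨v, d, h₁, h₂, h₃, h₄, h₅, h₆, h₇⟩ := hc.reverse.exists_next hi
  rw [Fin.rev_rev] at h₂ h₅ h₇
  exact ⟨d, v, h₂, h₁, h₃.reverse, h₇, h₆, h₅, h₄⟩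

theorem isSource_of_t_eq_zero {s : V} (h₀ : L.t 0 s = 0) (h₁ : L.t 1 s = 0) : K.IsSource s := by
  intro i u e
  have := L.step e
  fin_cases i <;> simp_all

/-- Descend from both vertices by the same two-edge move until both are sources; going back up is
deterministic. -/
theorem IsCritical.eq_of_t_eq {L : Labelling K} (hs : ∃! s, K.IsSource s) {c c' : V} (hc : L.IsCritical c)
    (hc' : L.IsCritical c') (h : ∀ i, L.t i c = L.t i c') : c = c' := by
  induction hn : L.t 0 c + L.t 1 c generalizing c c' with
  | zero =>
    have h₀ := h 0
    have h₁ := h 1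
    exact hs.unique (L.isSource_of_t_eq_zero (by omega) (by omega))
      (L.isSource_of_t_eq_zero (by omega) (by omega))
  | succ n ih =>
    obtain ⟨i, hi⟩ : ∃ i : Fin 2, 0 < L.t i.rev c := by
      by_cases h₁ : 0 < L.t 1 c
      · exact ⟨0, h₁⟩
      · exact ⟨1, show 0 < L.t 0 c by omega⟩
    obtain ⟨d, v, e₁, e₂, hd, h₁, h₂, -⟩ := hc.exists_prev hi
    obtain ⟨d', v', e₁', e₂', hd', h₁', h₂', -⟩ := hc'.exists_prev (h i.rev ▸ hi)
    have hi₁ := h i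
    have hi₂ := h i.rev
    have hc₁ := t_add_rev (L := L) i c
    have hd₁ := t_add_rev (L := L) i d
    obtain rfl : d = d' := by
      refine ih hd hd' (fun j => ?_) (by omega)
      rcases eq_or_eq_rev i j with rfl | rfl <;> omega
    obtain rfl := L.out_unique e₁ e₁'
    exact L.out_unique e₂ e₂'

theorem exists_walks_of_E₁ (hs : ∃! s, K.IsSource s) {u v v' : V} (e : L.E₁ 0 u v)
    (e' : L.E₁ 1 u v') : ∃ w, K.Walk [0, 1, 1, 0] u w ∧ K.Walk [1, 0, 0, 1] u w := by
  have hu := L.isCritical_of_E₁ e e'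
  have h₀ := (L.step (edge₁ e)).2
  have h₁ := (L.step (edge₁ e')).2
  obtain ⟨a, b, ha, hb, hbc, hb₁, hb₂, hb₃, hb₄⟩ := hu.exists_next (i := 0) (by omega)
  obtain ⟨a', b', ha', hb', hbc', hb₁', hb₂', hb₃', hb₄'⟩ := hu.exists_next (i := 1) (by omega)
  change L.t 1 b = L.t 1 u + 1 at hb₂
  change L.h 1 b = L.h 1 u at hb₄
  change L.t 0 b' = L.t 0 u + 1 at hb₂'
  change L.h 0 b' = L.h 0 u at hb₄'
  obtain ⟨p, q, hp, hq, hqc, hq₁, hq₂, -⟩ := hbc.exists_next (i := 1) (by omega)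
  obtain ⟨p', q', hp', hq', hqc', hq₁', hq₂', -⟩ := hbc'.exists_next (i := 0) (by omega)
  change L.t 0 q = L.t 0 b + 1 at hq₂
  change L.t 1 q' = L.t 1 b' + 1 at hq₂'
  obtain rfl : q = q' := by
    refine hqc.eq_of_t_eq hs hqc' (fun j => ?_)
    fin_cases j <;> simp only [Fin.zero_eta, Fin.mk_one] <;> omega
  exact ⟨q, ⟨a, ha, b, hb, p, hp, q, hq, rfl⟩, ⟨a', ha', b', hb', p', hp', q, hq', rfl⟩⟩

/-- Not the reversal of `exists_walks_of_E₁`, which would require a unique sink. The descent starts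
at `v` instead. -/
theorem exists_walks_of_E₀ (hs : ∃! s, K.IsSource s) {u u' v : V} (e : L.E₀ 0 u v)
    (e' : L.E₀ 1 u' v) : ∃ w, K.Walk [0, 1, 1, 0] w v ∧ K.Walk [1, 0, 0, 1] w v := by
  have hv : L.IsCritical v := (L.reverse.isCritical_of_E₁ (u := v) e e').reverse
  have h₀ := (L.step (edge₀ e)).1
  have h₁ := (L.step (edge₀ e')).1
  obtain ⟨b, a, hb, ha, hbc, hb₁, hb₂, -⟩ := hv.exists_prev (i := 1) (show 0 < L.t 0 v by omega)
  obtain ⟨b', a', hb', ha', hbc', hb₁', hb₂', -⟩ :=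
    hv.exists_prev (i := 0) (show 0 < L.t 1 v by omega)
  change L.t 0 v = L.t 0 b + 1 at hb₂
  change L.t 1 v = L.t 1 b' + 1 at hb₂'
  obtain ⟨q, p, hq, hp, hqc, hq₁, hq₂, -⟩ := hbc.exists_prev (i := 0) (show 0 < L.t 1 b by omega)
  obtain ⟨q', p', hq', hp', hqc', hq₁', hq₂', -⟩ :=
    hbc'.exists_prev (i := 1) (show 0 < L.t 0 b' by omega)
  change L.t 0 b' = L.t 0 q' + 1 at hq₂'
  change L.t 1 b = L.t 1 q + 1 at hq₂
  obtain rfl : q = q' := by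
    refine hqc.eq_of_t_eq hs hqc' (fun j => ?_)
    fin_cases j <;> simp only [Fin.zero_eta, Fin.mk_one] <;> omega
  exact ⟨q, ⟨p, hq, b, hp, a, hb, v, ha, rfl⟩, ⟨p', hq', b', hp', a', hb', v, ha', rfl⟩⟩

/-! ### Both equivalences for a labelling -/

theorem reverse_isConnected (hK : K.IsConnected) : K.reverse.IsConnected := by
  refine ⟨hK.1, fun u v => ?_⟩
  induction hK.2 u v with
  | rel x y h => exact .symm _ _ (.rel _ _ h)
  | refl x => exact .refl x
  | symm x y _ ih => exact ih.symm
  | trans x y z _ _ ih₁ ih₂ => exact ih₁.trans _ _ _ ih₂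

/-- The colour word is a palindrome, so reversing the edges leaves it unchanged. -/
theorem walk_reverse (i : Fin 2) {u w : V} :
    K.reverse.Walk [i, i.rev, i.rev, i] u w ↔ K.Walk [i, i.rev, i.rev, i] w u := by
  constructor <;>
  · rintro ⟨a, ha, b, hb, c, hc, d, hd, h⟩
    cases h
    exact ⟨c, hd, b, hc, a, hb, _, ha, rfl⟩

/-- The two parts of axiom (A4), in terms of a labelling. -/
def A4 (L : Labelling K) : Prop :=
  (∀ u v v', L.E₁ 0 u v → L.E₁ 1 u v' → ∃ w, K.Walk [0, 1, 1, 0] u w ∧ K.Walk [1, 0, 0, 1] u w) ∧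
  (∀ u u' v, L.E₀ 0 u v → L.E₀ 1 u' v → ∃ w, K.Walk [0, 1, 1, 0] w v ∧ K.Walk [1, 0, 0, 1] w v)

theorem A4.reverse (hA4 : L.A4) : L.reverse.A4 := by
  refine ⟨fun u v v' e e' => ?_, fun u u' v e e' => ?_⟩
  · obtain ⟨w, h₁, h₂⟩ := hA4.2 _ _ _ e e'
    exact ⟨w, (walk_reverse 0).2 h₁, (walk_reverse 1).2 h₂⟩
  · obtain ⟨w, h₁, h₂⟩ := hA4.1 _ _ _ e e'
    exact ⟨w, (walk_reverse 0).2 h₁, (walk_reverse 1).2 h₂⟩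

theorem A4_iff_existsUnique_source (hK : K.IsConnected) : L.A4 ↔ ∃! s, K.IsSource s := by
  refine ⟨fun hA4 => L.existsUnique_source hK fun u u' v e e' => ?_, fun hs =>
    ⟨fun _ _ _ => L.exists_walks_of_E₁ hs, fun _ _ _ => L.exists_walks_of_E₀ hs⟩⟩
  obtain ⟨w, ⟨a, ha, b, hb, c, hc, d, hd, rfl⟩, ⟨a', ha', b', hb', c', hc', d', hd', rfl⟩⟩ :=
    hA4.2 u u' v e e'
  obtain rfl := L.in_unique (edge₀ e) hd
  obtain rfl := L.in_unique (edge₀ e') hd'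
  exact ⟨w, ((Relation.ReflTransGen.single ⟨_, ha⟩).tail ⟨_, hb⟩).tail ⟨_, hc⟩,
    ((Relation.ReflTransGen.single ⟨_, ha'⟩).tail ⟨_, hb'⟩).tail ⟨_, hc'⟩⟩

theorem A4_iff_existsUnique_sink (hK : K.IsConnected) : L.A4 ↔ ∃! s, K.IsSink s :=
  ⟨fun h => (L.reverse.A4_iff_existsUnique_source (reverse_isConnected hK)).1 (A4.reverse L h),
    fun h => A4.reverse L.reverse
      ((L.reverse.A4_iff_existsUnique_source (reverse_isConnected hK)).2 h)⟩

end Labelling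

/-! ### From (A1)–(A3) to a labelling -/

section Lines

variable {K : TwoColoredDigraph V}

theorem eqvGen_of_reflTransGen {r : V → V → Prop} {u v : V} (h : Relation.ReflTransGen r u v) :
    Relation.EqvGen r u v := by
  induction h with
  | refl => exact .refl _
  | tail _ e ih => exact ih.trans _ _ _ (.rel _ _ e)

theorem A1.out_unique (hK : K.A1) {i : Fin 2} {u v v' : V} (e : K.E i u v) (e' : K.E i u v') :
    v = v' := by
  obtain ⟨n, p, hp, -, hE⟩ := hK i u
  obtain ⟨k, hk, rfl⟩ := (hE u (.refl _) v (.rel _ _ e)).1 e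
  obtain ⟨k', hk', rfl⟩ := (hE u (.refl _) v' (.rel _ _ e')).1 e'
  obtain rfl : k = k' := Fin.castSucc_injective n (hp (hk ▸ hk'))
  rfl

theorem A1.in_unique (hK : K.A1) {i : Fin 2} {u u' v : V} (e : K.E i u v) (e' : K.E i u' v) :
    u = u' := by
  obtain ⟨n, p, hp, -, hE⟩ := hK i v
  obtain ⟨k, rfl, hk⟩ := (hE u (.symm _ _ (.rel _ _ e)) v (.refl _)).1 e
  obtain ⟨k', rfl, hk'⟩ := (hE u' (.symm _ _ (.rel _ _ e')) v (.refl _)).1 e'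
  obtain rfl : k = k' := Fin.succ_injective n (hp (hk ▸ hk'))
  rfl

theorem A1.not_reflTransGen (hK : K.A1) {i : Fin 2} {u v : V} (e : K.E i u v) :
    ¬ Relation.ReflTransGen (K.E i) v u := by
  obtain ⟨n, p, hp, -, hE⟩ := hK i u
  have hv : v ∈ K.line i u := .rel _ _ e
  obtain ⟨k, hk, rfl⟩ := (hE u (.refl _) v hv).1 e
  have key : ∀ w, Relation.ReflTransGen (K.E i) (p k.succ) w → ∃ l, k.succ ≤ l ∧ w = p l := by
    intro w hw
    induction hw with
    | refl => exact ⟨_, le_rfl, rfl⟩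
    | @tail x y hx e' ih =>
      obtain ⟨l, hl, rfl⟩ := ih
      have hxl : p l ∈ K.line i u := hv.trans _ _ _ (eqvGen_of_reflTransGen hx)
      obtain ⟨m, hm, rfl⟩ := (hE _ hxl y (hxl.trans _ _ _ (.rel _ _ e'))).1 e'
      obtain rfl := hp hm
      exact ⟨_, hl.trans Fin.castSucc_lt_succ.le, rfl⟩
  intro h
  obtain ⟨l, hl, hul⟩ := key _ h
  obtain rfl := hp (hk.symm.trans hul)
  exact absurd hl (not_le.2 Fin.castSucc_lt_succ)

theorem A1.finite_line (hK : K.A1) (i : Fin 2) (v : V) : (K.line i v).Finite := by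
  obtain ⟨n, p, -, hp, -⟩ := hK i v
  exact hp ▸ Set.finite_range p

theorem A1.reflTransGen_total (hK : K.A1) {i : Fin 2} {x y : V} (hy : y ∈ K.line i x) :
    Relation.ReflTransGen (K.E i) x y ∨ Relation.ReflTransGen (K.E i) y x := by
  obtain ⟨n, p, -, hp, hE⟩ := hK i x
  have key : ∀ (m : ℕ) (a b : Fin (n + 1)), (b : ℕ) = a + m →
      Relation.ReflTransGen (K.E i) (p a) (p b) := by
    intro m
    induction m with
    | zero => intro a b h; rw [Fin.ext (h.trans (add_zero _))]
    | succ m ih =>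
      intro a b h
      have hb := b.isLt
      let k : Fin n := ⟨a + m, by omega⟩
      have hkb : b = k.succ := Fin.ext (by simp [k, h, add_assoc])
      rw [hkb]
      exact (ih a k.castSucc rfl).tail ((hE _ (hp ▸ ⟨_, rfl⟩) _ (hp ▸ ⟨_, rfl⟩)).2 ⟨k, rfl, rfl⟩)
  obtain ⟨a, rfl⟩ : x ∈ Set.range p := hp ▸ .refl x
  obtain ⟨b, rfl⟩ : y ∈ Set.range p := hp ▸ hy
  rcases le_total a b with h | h
  · exact .inl (key (b - a) a b (by have : (a : ℕ) ≤ b := h; omega))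
  · exact .inr (key (a - b) b a (by have : (b : ℕ) ≤ a := h; omega))

/-- Needed because `Set.ncard` is `0` on infinite sets; finiteness lets one more edge raise `t` by
one. -/
theorem A1.finite_inEdges (hK : K.A1) (i : Fin 2) (v : V) : (K.inEdges i v).Finite := by
  refine ((hK.finite_line i v).prod (hK.finite_line i v)).subset fun e ⟨he, h⟩ => ?_
  have h₂ : e.2 ∈ K.line i v := (eqvGen_of_reflTransGen h).symm
  exact ⟨h₂.trans _ _ _ (.symm _ _ (.rel _ _ he)), h₂⟩

theorem A1.finite_outEdges (hK : K.A1) (i : Fin 2) (v : V) : (K.outEdges i v).Finite := by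
  refine ((hK.finite_line i v).prod (hK.finite_line i v)).subset fun e ⟨he, h⟩ => ?_
  have h₁ : e.1 ∈ K.line i v := eqvGen_of_reflTransGen h
  exact ⟨h₁, h₁.trans _ _ _ (.rel _ _ he)⟩

theorem A1.t_eq (hK : K.A1) {i : Fin 2} {u v : V} (e : K.E i u v) : K.t i v = K.t i u + 1 := by
  have : K.inEdges i v = insert (u, v) (K.inEdges i u) := by
    ext ⟨x, y⟩
    constructor
    · rintro ⟨hxy, h⟩
      rcases h.cases_tail with rfl | ⟨z, hz, e'⟩
      · exact .inl (Prod.ext (hK.in_unique hxy e) rfl)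
      · exact .inr ⟨hxy, hK.in_unique e' e ▸ hz⟩
    · rintro (h | ⟨hxy, h⟩)
      · cases h
        exact ⟨e, .refl⟩
      · exact ⟨hxy, h.tail e⟩
  rw [t, t, this]
  exact Set.ncard_insert_of_notMem (fun h => hK.not_reflTransGen e h.2) (hK.finite_inEdges i u)

theorem A1.h_eq (hK : K.A1) {i : Fin 2} {u v : V} (e : K.E i u v) : K.h i u = K.h i v + 1 := by
  have : K.outEdges i u = insert (u, v) (K.outEdges i v) := by
    ext ⟨x, y⟩
    constructor
    · rintro ⟨hxy, h⟩
      rcases h.cases_head with rfl | ⟨z, e', hz⟩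
      · exact .inl (Prod.ext rfl (hK.out_unique hxy e))
      · exact .inr ⟨hxy, hK.out_unique e' e ▸ hz⟩
    · rintro (h | ⟨hxy, h⟩)
      · cases h
        exact ⟨e, .refl⟩
      · exact ⟨hxy, h.head e⟩
  rw [h, h, this]
  exact Set.ncard_insert_of_notMem (fun h => hK.not_reflTransGen e h.2) (hK.finite_outEdges i v)

theorem exists_in_of_t_pos {i : Fin 2} {v : V} (hv : 0 < K.t i v) : ∃ u, K.E i u v := by
  obtain ⟨⟨x, y⟩, hxy, h⟩ := Set.nonempty_of_ncard_ne_zero hv.ne'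
  rcases h.cases_tail with h | ⟨z, -, e⟩
  · cases h
    exact ⟨x, hxy⟩
  · exact ⟨z, e⟩

theorem exists_out_of_h_pos {i : Fin 2} {v : V} (hv : 0 < K.h i v) : ∃ w, K.E i v w := by
  obtain ⟨⟨x, y⟩, hxy, h⟩ := Set.nonempty_of_ncard_ne_zero hv.ne'
  rcases h.cases_head with h | ⟨z, e, -⟩
  · cases h
    exact ⟨y, hxy⟩
  · exact ⟨z, e⟩

/-- The effect of an edge on the lengths `t` and `h` of the other colour. -/
theorem A2.t_h_rev (hA1 : K.A1) (hA2 : K.A2) {i : Fin 2} {u v : V} (e : K.E i u v) :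
    (K.t i.rev u = K.t i.rev v + 1 ∧ K.h i.rev u = K.h i.rev v) ∨
      (K.t i.rev u = K.t i.rev v ∧ K.h i.rev v = K.h i.rev u + 1) := by
  obtain ⟨r, hr, hin, hout⟩ := hA2 i u
  -- The critical vertex `r` cannot lie strictly between the ends of an edge.
  have : Relation.ReflTransGen (K.E i) v r ∨ Relation.ReflTransGen (K.E i) r u := by
    rcases hA1.reflTransGen_total hr with h | h
    · rcases h.cases_head with rfl | ⟨z, e', hz⟩
      · exact .inr .refl
      · exact .inl (hA1.out_unique e' e ▸ hz)
    · exact .inr h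
  rcases this with h | h
  · have := hin u v ⟨e, h⟩
    exact .inl ⟨by omega, this.2.symm⟩
  · have := hout u v ⟨e, h⟩
    exact .inr ⟨this.1.symm, this.2⟩

theorem label_eq_zero_or_one (K : TwoColoredDigraph V) (i : Fin 2) (u v : V) :
    K.label i u v = 0 ∨ K.label i u v = 1 := by
  unfold label
  split_ifs <;> simp

theorem label_eq_zero_iff {i : Fin 2} {u v : V} :
    K.label i u v = 0 ↔ K.h i.rev u = K.h i.rev v := by
  unfold label
  split_ifs <;> simp_all

/-- The labelling of a digraph that satisfies (A1)–(A3). -/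
noncomputable def labelling (hA1 : K.A1) (hA2 : K.A2) (hA3 : K.A3) : Labelling K where
  E₀ i u v := K.E i u v ∧ K.label i u v = 0
  E₁ i u v := K.E i u v ∧ K.label i u v = 1
  t := K.t
  h := K.h
  edge_iff {i u v} := by
    have := K.label_eq_zero_or_one i u v
    tauto
  out_unique := hA1.out_unique
  in_unique := hA1.in_unique
  exists_in := exists_in_of_t_pos
  exists_out := exists_out_of_h_pos
  step e := ⟨hA1.t_eq e, hA1.h_eq e⟩
  step₀ {i u v} e := by
    have h₁ := label_eq_zero_iff.1 e.2
    have := hA2.t_h_rev hA1 e.1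
    omega
  step₁ {i u v} e := by
    have h₁ : ¬ K.h i.rev u = K.h i.rev v := fun h => by
      have := label_eq_zero_iff.2 h
      have := e.2
      omega
    have := hA2.t_h_rev hA1 e.1
    omega
  square_out {i u v v'} e e' := by
    obtain ⟨h, w, ⟨a, ha, b, hb, rfl⟩, ⟨a', ha', b', hb', h'⟩⟩ := hA3.1 i u v v' e.1 e' e.2
    cases h'
    refine ⟨⟨e', h⟩, b, ?_⟩
    have := e.1
    fin_cases i
    · exact ⟨hA1.out_unique ha this ▸ hb, hA1.out_unique ha' e' ▸ hb'⟩
    · exact ⟨hA1.out_unique ha' this ▸ hb', hA1.out_unique ha e' ▸ hb⟩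
  square_in {i u u' v} e e' := by
    obtain ⟨h, w, ⟨a, ha, b, hb, hw⟩, ⟨a', ha', b', hb', hw'⟩⟩ := hA3.2 i u u' v e.1 e' e.2
    cases hw
    cases hw'
    refine ⟨⟨e', h⟩, w, ?_⟩
    have := e.1
    fin_cases i
    · exact ⟨hA1.in_unique hb this ▸ ha, hA1.in_unique hb' e' ▸ ha'⟩
    · exact ⟨hA1.in_unique hb' this ▸ ha', hA1.in_unique hb e' ▸ ha⟩

theorem labelling_A4_iff (hA1 : K.A1) (hA2 : K.A2) (hA3 : K.A3) :
    (labelling hA1 hA2 hA3).A4 ↔ K.A4 :=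
  ⟨fun h => ⟨fun u v v' e e' l l' => h.1 u v v' ⟨e, l⟩ ⟨e', l'⟩,
      fun u u' v e e' l l' => h.2 u u' v ⟨e, l⟩ ⟨e', l'⟩⟩,
    fun h => ⟨fun u v v' e e' => h.1 u v v' e.1 e'.1 e.2 e'.2,
      fun u u' v e e' => h.2 u u' v e.1 e'.1 e.2 e'.2⟩⟩

theorem A4_iff_existsUnique_source_and_sink (hK : K.IsConnected) (hA1 : K.A1) (hA2 : K.A2)
    (hA3 : K.A3) : (K.A4 ↔ ∃! s, K.IsSource s) ∧ (K.A4 ↔ ∃! s, K.IsSink s) := by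
  rw [← labelling_A4_iff hA1 hA2 hA3]
  exact ⟨Labelling.A4_iff_existsUnique_source _ hK, Labelling.A4_iff_existsUnique_sink _ hK⟩

end Lines

end TwoColoredDigraph

theorem corollary4 {V : Type*} (K : TwoColoredDigraph V) :
    (K.IsConnected → K.A1 → K.A2 → K.A3 →
      (K.A4 ↔ ∃! s : V, K.IsSource s) ∧ (K.A4 ↔ ∃! s : V, K.IsSink s)) ∧
    (K.IsRCGraph ↔ K.IsWCGraph ∧ ∃! s : V, K.IsSource s) ∧
    (K.IsRCGraph ↔ K.IsWCGraph ∧ ∃! s : V, K.IsSink s) := by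
  have key : K.IsConnected → K.A1 → K.A2 → K.A3 →
      (K.A4 ↔ ∃! s : V, K.IsSource s) ∧ (K.A4 ↔ ∃! s : V, K.IsSink s) :=
    TwoColoredDigraph.A4_iff_existsUnique_source_and_sink
  refine ⟨key, ⟨?_, ?_⟩, ⟨?_, ?_⟩⟩
  · rintro ⟨h, h₁, h₂, h₃, h₄⟩
    exact ⟨⟨h, h₁, h₂, h₃⟩, (key h h₁ h₂ h₃).1.1 h₄⟩
  · rintro ⟨⟨h, h₁, h₂, h₃⟩, hs⟩
    exact ⟨h, h₁, h₂, h₃, (key h h₁ h₂ h₃).1.2 hs⟩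
  · rintro ⟨h, h₁, h₂, h₃, h₄⟩
    exact ⟨⟨h, h₁, h₂, h₃⟩, (key h h₁ h₂ h₃).2.1 h₄⟩
  · rintro ⟨⟨h, h₁, h₂, h₃⟩, hs⟩
    exact ⟨h, h₁, h₂, h₃, (key h h₁ h₂ h₃).2.2 hs⟩
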